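/- Let $n\ge 2$. A design is a set of points $0=x_1<x_2<\dots<x_n=1$ in $\mathcal D=[0,1]$; write $\xi=(d_1,\dots,d_{n-1})$, $d_i=x_{i+1}-x_i$. Let $(Z_1,Z_2)$ be an isotropic bivariate process on $[0,1]$ with unknown constant means, $\mathrm{Cov}(Z_i(x),Z_j(x'))=C_{ij}(|x-x'|)$ and $C_{11}(h)=\sigma_{11}e^{-\theta h}$, $\theta,\sigma_{11}>0$, both components being observed at $x_1,\dots,x_n$. Assume that the covariance is * either of generalized Markov type: $C_{12}=C_{21}=\rho\, C_{11}$ and $C_{22}=\rho^2C_{11}+(\sigma_{22}-\rho^2\sigma_{11})C_R$ with real $\rho,\sigma_{22}$, $\sigma_{22}-\rho^2\sigma_{11}>0$, and a (strictly positive definite) correlogram $C_R$; * or proportional: $C_{ij}=\sigma_{ij}C_Q$ with a positive definite matrix $(\sigma_{ij})_{i,j\le 2}$ and a function $C_Q$. Let $\Sigma$ be the $2n\times 2n$ covariance matrix of all observations, $\sigma_0$ the vector of their covariances with $Z_1(x_0)$, $f_0=(1,0)^T$ and $F_0=\begin{pmatrix}\mathbf 1_n&\mathbf 0_n\\ \mathbf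 0_n&\mathbf 1_n\end{pmatrix}$. The mean squared prediction error of the ordinary cokriging predictor of $Z_1(x_0)$ is $$MSPE_{ock}(x_0)=C_{11}(0)-\sigma_0^T\Sigma^{-1}\sigma_0+(f_0-F_0^T\Sigma^{-1}\sigma_0)^T(F_0^T\Sigma^{-1}F_0)^{-1}(f_0-F_0^T\Sigma^{-1}\sigma_0),$$ and $IMSPE_{ock}(\theta,\sigma_{11},\xi)=\int_0^1 MSPE_{ock}(x_0)\,dx_0$. Then $MSPE_{ock}$ is integrable on $[0,1]$, $IMSPE_{ock}\ge 0$, and $$IMSPE_{ock}(\theta,\sigma_{11},\xi)=\sigma_{11}\Big(1-\frac{n-1}{\theta}+2\Phi(\xi)+\frac{G(\xi)}{F(\xi)}\Big),$$ where $\Phi(\xi)=\sum_{i=1}^{n-1}\phi(d_i)$, $G(\xi)=\sum_{i=1}^{n-1}g(d_i)$, $F(\xi)=\sum_{i=1}^{n-1}\omega(d_i)$ with $$\phi(d)=\frac{d}{e^{2\theta d}-1},\qquad g(d)=d+\frac{3(1-e^{2\theta d})+2\theta d\,e^{\theta d}}{\theta(1+e^{\theta d})^2},\qquad \omega(d)=d+\frac{e^{\theta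 d}-1}{e^{\theta d}+1}.$$ Suppose now that $\theta$ and $\sigma_{11}$ are unknown and are given independent priors with probability densities $r$ and $t$, where $r$ vanishes outside an interval $(\theta_1,\theta_2)$ with $0<\theta_1<\theta_2<\infty$ and $t$ vanishes outside $(0,\infty)$, and that for all $\theta,\sigma_{11}$ with $r(\theta)>0$, $t(\sigma_{11})>0$ the covariance is as above (its other parameters may depend on $\theta$ and $\sigma_{11}$). Then the equispaced design, $d_i=\frac1{n-1}$ for all $i$, minimizes the Bayesian risk $$\mathcal R_4(\xi)=E\big[IMSPE_{ock}(\theta,\sigma_{11},\xi)\big]\in[0,\infty]$$ over all $n$-point designs $\xi$. If $E[\sigma_{11}]<\infty$, the risk of every design is finite. -/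

import Mathlib

open MeasureTheory ProbabilityTheory

namespace Cokriging

noncomputable section

/-- An isotropic bivariate (cross-)covariance: `C i j h` is the covariance of `Z_i(x)` and `Z_j(x')`
at distance `h = |x - x'|`.  Index `0` is the primary variable, index `1` the secondary one. -/
abbrev IsoCov := Fin 2 → Fin 2 → ℝ → ℝ

/-- A valid correlogram: value `1` at distance `0`, and every correlation matrix at finitely many
distinct points of the line is positive definite. -/
def IsCorrelogram (R : ℝ → ℝ) : Prop :=
  R 0 = 1 ∧ ∀ (k : ℕ) (y : Fin k → ℝ), Function.Injective y →
    (Matrix.of fun i j => R |y i - y j|).PosDef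

/-- Generalized Markov-type covariance; here `C 0 0 0` is the variance of the primary variable. -/
def IsGenMarkov (C : IsoCov) : Prop :=
  ∃ (ρ σ₂₂ : ℝ) (R : ℝ → ℝ), IsCorrelogram R ∧ 0 < σ₂₂ - ρ ^ 2 * C 0 0 0 ∧
    ∀ h : ℝ, 0 ≤ h →
      C 0 1 h = ρ * C 0 0 h ∧ C 1 0 h = C 0 1 h ∧
      C 1 1 h = ρ ^ 2 * C 0 0 h + (σ₂₂ - ρ ^ 2 * C 0 0 0) * R h

/-- Proportional covariance.  (That `Q` is a valid covariance function is not required here: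
it follows once `C 0 0` is known to be one.) -/
def IsProportional (C : IsoCov) : Prop :=
  ∃ (T : Matrix (Fin 2) (Fin 2) ℝ) (Q : ℝ → ℝ), T.PosDef ∧
    ∀ (i j : Fin 2) (h : ℝ), 0 ≤ h → C i j h = T i j * Q h

/-- A covariance of one of the two families whose primary variable is an Ornstein-Uhlenbeck
process with parameter `θ` and variance `σ₁₁`. -/
def IsReducedModel (C : IsoCov) (θ σ₁₁ : ℝ) : Prop :=
  (∀ h : ℝ, 0 ≤ h → C 0 0 h = σ₁₁ * Real.exp (-θ * h)) ∧ (IsGenMarkov C ∨ IsProportional C)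

/-- A design on `[0,1]` with `n = m + 1` ordered distinct points, both end points included. -/
def IsDesign {m : ℕ} (x : Fin (m + 1) → ℝ) : Prop :=
  StrictMono x ∧ x 0 = 0 ∧ x (Fin.last m) = 1

/-- The equispaced design with `m + 1` points. -/
def equispaced (m : ℕ) : Fin (m + 1) → ℝ := fun i => (i : ℝ) / (m : ℝ)

/-- The distance `d_i` between consecutive design points. -/
def gap {m : ℕ} (x : Fin (m + 1) → ℝ) (i : Fin m) : ℝ := x i.succ - x i.castSucc

/-- The matrix `Cov(Z_i, Z_j)` at the design points. -/
def covBlock {n : ℕ} (C : IsoCov) (x : Fin n → ℝ) (i j : Fin 2) : Matrix (Fin n) (Fin n) ℝ :=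
  Matrix.of fun k l => C i j |x k - x l|

/-- The covariance matrix of the vector of all `2n` observations. -/
def covMat {n : ℕ} (C : IsoCov) (x : Fin n → ℝ) : Matrix (Fin n ⊕ Fin n) (Fin n ⊕ Fin n) ℝ :=
  Matrix.fromBlocks (covBlock C x 0 0) (covBlock C x 0 1) (covBlock C x 1 0) (covBlock C x 1 1)

/-- The covariances of all observations with `Z_0 = Z_1(x₀)`, the primary variable at `x₀`. -/
def covVec {n : ℕ} (C : IsoCov) (x : Fin n → ℝ) (x₀ : ℝ) : Fin n ⊕ Fin n → ℝ :=
  Sum.elim (fun k => C 0 0 |x k - x₀|) (fun k => C 1 0 |x k - x₀|)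

/-- The drift matrix of ordinary cokriging (two unknown constant means). -/
def driftMat (n : ℕ) : Matrix (Fin n ⊕ Fin n) (Unit ⊕ Unit) ℝ :=
  Matrix.fromBlocks (Matrix.of fun _ _ => 1) 0 0 (Matrix.of fun _ _ => 1)

/-- The drift vector `(1, 0)` at the prediction point. -/
def driftVec : Unit ⊕ Unit → ℝ := Sum.elim (fun _ => 1) (fun _ => 0)

/-- The mean squared prediction error of the ordinary cokriging predictor at `x₀`:
`σ₀₀ - σ₀ᵀ Σ⁻¹ σ₀ + (f₀ - Fᵀ Σ⁻¹ σ₀)ᵀ (Fᵀ Σ⁻¹ F)⁻¹ (f₀ - Fᵀ Σ⁻¹ σ₀)`. -/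
def mspeOck {n : ℕ} (C : IsoCov) (x : Fin n → ℝ) (x₀ : ℝ) : ℝ :=
  let A := (covMat C x)⁻¹
  let s := covVec C x x₀
  let F := driftMat n
  let u := driftVec - F.transpose.mulVec (A.mulVec s)
  C 0 0 0 - s ⬝ᵥ A.mulVec s + u ⬝ᵥ ((F.transpose * A * F)⁻¹).mulVec u

/-- The integrated mean squared prediction error over `[0,1]`. -/
def imspeOck {n : ℕ} (C : IsoCov) (x : Fin n → ℝ) : ℝ := ∫ x₀ in (0 : ℝ)..1, mspeOck C x x₀

/-- `φ(d)`. -/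
def phi (θ d : ℝ) : ℝ := d / (Real.exp (2 * θ * d) - 1)

/-- `g(d)`. -/
def gFun (θ d : ℝ) : ℝ :=
  d + (3 * (1 - Real.exp (2 * θ * d)) + 2 * θ * d * Real.exp (θ * d)) /
    (θ * (1 + Real.exp (θ * d)) ^ 2)

/-- `ω(d)`. -/
def omegaFun (θ d : ℝ) : ℝ := d + (Real.exp (θ * d) - 1) / (Real.exp (θ * d) + 1)

/-- `σ₁₁ (1 - (n-1)/θ + 2 Φ + G / F)` with `n - 1 = m`. -/
def imspeFormula {m : ℕ} (θ σ₁₁ : ℝ) (x : Fin (m + 1) → ℝ) : ℝ :=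
  σ₁₁ * (1 - (m : ℝ) / θ + 2 * ∑ i : Fin m, phi θ (gap x i) +
    (∑ i : Fin m, gFun θ (gap x i)) / ∑ i : Fin m, omegaFun θ (gap x i))

/-- The Bayesian risk, the expectation in `[0, ∞]` of the IMSPE of the design `x` when the
covariance is `M θ σ₁₁` and `θ`, `σ₁₁` are the random variables `Θ`, `S`. -/
def risk {Ω : Type*} [MeasurableSpace Ω] (P : Measure Ω) (Θ S : Ω → ℝ) (M : ℝ → ℝ → IsoCov)
    {n : ℕ} (x : Fin n → ℝ) : ENNReal :=
  ∫⁻ w, ENNReal.ofReal (imspeOck (M (Θ w) (S w)) x) ∂P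

end

end Cokriging

open Cokriging

/-!
In both covariance families the covariance matrix of all observations has blocks `K`, `ρ K`, `ρ K`,
`ρ² K + B` with `K` the matrix of the primary variable and `B` positive definite
(`IsReducedModel.exists_markov_blocks`). The second component is then `ρ` times the first plus an
uncorrelated residual, so it does not help the prediction: the cokriging error equals the ordinary
kriging error of the primary variable alone (`mspeOck_eq_of_markov_blocks`).

Kriging an Ornstein-Uhlenbeck process is explicit. By the Markov property the simple kriging weights
`K⁻¹ k` are supported on the two neighbours of the prediction point
(`expCorr_mulVec_krigWeight`), and `K⁻¹ 1` has a closed form with coordinate sum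
`1 + ∑ tanh (θ d_i / 2)` (`expCorr_mulVec_unitWeight`, `sum_unitWeight`). Neither needs the inverse
of `K`, only its invertibility, which follows from an `L D Lᵀ` factorization (`posDef_expCorr`).
The error on a gap is therefore a hyperbolic expression, and integrating it gap by gap gives the
closed form (`imspeOck_eq`).

In that closed form `φ` and `g` are convex, while the denominator is a constant plus a sum of concave
functions `tanh`. By Jensen's inequality equal gaps minimize the sums of `φ` and `g` and maximize the
denominator, so they minimize the integrated error for each value of the parameters
(`imspeFormula_equispaced_le`), hence also on average. The bound `2 σ₁₁` on the integrated error
(`imspeFormula_le`) gives finiteness of the risk when `σ₁₁` has finite expectation.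
-/

namespace Cokriging

open scoped Matrix

/-! ### Reduction of cokriging to kriging of the primary variable -/

lemma inv_fromBlocks_markov {n : ℕ} {K B : Matrix (Fin n) (Fin n) ℝ} (hK : IsUnit K.det)
    (hB : IsUnit B.det) (ρ : ℝ) :
    (Matrix.fromBlocks K (ρ • K) (ρ • K) (ρ ^ 2 • K + B))⁻¹ =
      Matrix.fromBlocks (K⁻¹ + ρ ^ 2 • B⁻¹) (-ρ • B⁻¹) (-ρ • B⁻¹) B⁻¹ := by
  apply Matrix.inv_eq_right_inv
  rw [Matrix.fromBlocks_multiply, ← Matrix.fromBlocks_one]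
  have h1 : K * K⁻¹ = 1 := Matrix.mul_nonsing_inv K hK
  have h2 : B * B⁻¹ = 1 := Matrix.mul_nonsing_inv B hB
  congr 1 <;> simp only [Matrix.mul_add, Matrix.add_mul, Matrix.smul_mul, Matrix.mul_smul, h1, h2]
  all_goals module

/-- In a model with blocks `K`, `ρ K`, `ρ² K + B` the secondary variable carries no information
about the primary one: the cokriging error is the error of ordinary kriging of the primary variable
alone.  Here `a = K⁻¹ k` with `k` the covariances to the prediction point, and `b = K⁻¹ 1`. -/
lemma mspeOck_eq_of_markov_blocks {n : ℕ} {C : IsoCov} {x : Fin n → ℝ} {x₀ ρ : ℝ}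
    {B : Matrix (Fin n) (Fin n) ℝ} {a b : Fin n → ℝ}
    (h01 : covBlock C x 0 1 = ρ • covBlock C x 0 0)
    (h10 : covBlock C x 1 0 = ρ • covBlock C x 0 0)
    (h11 : covBlock C x 1 1 = ρ ^ 2 • covBlock C x 0 0 + B)
    (hv : ∀ k, C 1 0 |x k - x₀| = ρ * C 0 0 |x k - x₀|)
    (hK : IsUnit (covBlock C x 0 0).det) (hB : B.PosDef)
    (ha : covBlock C x 0 0 *ᵥ a = fun k => C 0 0 |x k - x₀|)
    (hb : covBlock C x 0 0 *ᵥ b = 1) (hb0 : ∑ k, b k ≠ 0) :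
    mspeOck C x x₀ = C 0 0 0 - ∑ k, C 0 0 |x k - x₀| * a k
      + (1 - ∑ k, a k) ^ 2 / ∑ k, b k := by
  set K := covBlock C x 0 0 with hKdef
  have hBu : IsUnit B.det := (Matrix.isUnit_iff_isUnit_det B).1 hB.isUnit
  have hA : (covMat C x)⁻¹ =
      Matrix.fromBlocks (K⁻¹ + ρ ^ 2 • B⁻¹) (-ρ • B⁻¹) (-ρ • B⁻¹) B⁻¹ := by
    rw [covMat, h01, h10, h11, inv_fromBlocks_markov hK hBu]
  have ha' : K⁻¹ *ᵥ (fun k => C 0 0 |x k - x₀|) = a := by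
    rw [← ha, Matrix.mulVec_mulVec, Matrix.nonsing_inv_mul K hK, Matrix.one_mulVec]
  have hb' : K⁻¹ *ᵥ (1 : Fin n → ℝ) = b := by
    rw [← hb, Matrix.mulVec_mulVec, Matrix.nonsing_inv_mul K hK, Matrix.one_mulVec]
  have hs : covVec C x x₀ =
      Sum.elim (fun k => C 0 0 |x k - x₀|) (ρ • fun k => C 0 0 |x k - x₀|) := by
    unfold covVec
    congr 1
    funext k
    simp [hv]
  have hAs : (covMat C x)⁻¹ *ᵥ covVec C x x₀ = Sum.elim a 0 := by
    rw [hA, hs, Matrix.fromBlocks_mulVec]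
    congr 1
    · simp only [Sum.elim_comp_inl, Sum.elim_comp_inr, Matrix.add_mulVec, ha', Matrix.smul_mulVec,
        Matrix.mulVec_smul]
      module
    · simp only [Sum.elim_comp_inl, Sum.elim_comp_inr, Matrix.smul_mulVec,
        Matrix.mulVec_smul]
      module
  set β : ℝ := (1 : Fin n → ℝ) ⬝ᵥ B⁻¹ *ᵥ 1 with hβ
  have hn : n ≠ 0 := by
    rintro rfl
    simp at hb0
  have hβ0 : 0 < β := by
    have := hB.inv.dotProduct_mulVec_pos (x := (1 : Fin n → ℝ)) (by
      intro h
      have := congrFun h ⟨0, Nat.pos_of_ne_zero hn⟩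
      simp at this)
    simpa using this
  have hα : (1 : Fin n → ℝ) ⬝ᵥ K⁻¹ *ᵥ 1 = ∑ k, b k := by
    rw [hb']; simp [dotProduct]
  set α : ℝ := ∑ k, b k
  have hone : ∀ A : Matrix (Fin n) (Fin n) ℝ,
      (Matrix.of fun _ _ => 1 : Matrix (Fin n) Unit ℝ).transpose * A *
        (Matrix.of fun _ _ => 1 : Matrix (Fin n) Unit ℝ) =
      Matrix.of fun _ _ => (1 : Fin n → ℝ) ⬝ᵥ A *ᵥ 1 := by
    intro A
    ext i j
    rw [Matrix.mul_assoc]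
    simp [Matrix.mul_apply, dotProduct, Matrix.mulVec]
  have hFAF : (driftMat n).transpose * (covMat C x)⁻¹ * driftMat n =
      Matrix.fromBlocks (Matrix.of fun _ _ => α + ρ ^ 2 * β) (Matrix.of fun _ _ => -ρ * β)
        (Matrix.of fun _ _ => -ρ * β) (Matrix.of fun _ _ => β) := by
    rw [hA, driftMat, Matrix.fromBlocks_transpose, Matrix.fromBlocks_multiply,
      Matrix.fromBlocks_multiply]
    simp only [Matrix.transpose_zero, Matrix.zero_mul, Matrix.mul_zero, add_zero, zero_add, hone]
    congr 1 <;> ext i j <;>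
      simp [Matrix.add_mulVec, Matrix.smul_mulVec, Matrix.neg_mulVec, hα, ← hβ]
  have hinv : ((driftMat n).transpose * (covMat C x)⁻¹ * driftMat n)⁻¹ =
      Matrix.fromBlocks (Matrix.of fun _ _ => 1 / α) (Matrix.of fun _ _ => ρ / α)
        (Matrix.of fun _ _ => ρ / α) (Matrix.of fun _ _ => 1 / β + ρ ^ 2 / α) := by
    apply Matrix.inv_eq_right_inv
    rw [hFAF, Matrix.fromBlocks_multiply, ← Matrix.fromBlocks_one]
    congr 1 <;> ext i j <;> simp [Matrix.mul_apply] <;> field_simp <;> ring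
  have hu : driftVec - (driftMat n).transpose *ᵥ (Sum.elim a 0) =
      Sum.elim (fun _ => 1 - ∑ k, a k) (fun _ => 0) := by
    rw [driftMat, Matrix.fromBlocks_transpose, Matrix.fromBlocks_mulVec]
    ext i
    rcases i with i | i <;> simp [driftVec, Matrix.mulVec, dotProduct]
  simp only [mspeOck]
  rw [hinv, hAs, hu, hs, Matrix.fromBlocks_mulVec]
  simp [dotProduct, Matrix.mulVec]
  field_simp

/-! ### The exponential correlation matrix -/

lemma sum_succ_sub_castSucc {m : ℕ} (f : Fin (m + 1) → ℝ) :
    ∑ i : Fin m, (f i.succ - f i.castSucc) = f (Fin.last m) - f 0 := by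
  have h1 := Fin.sum_univ_succ f
  have h2 := Fin.sum_univ_castSucc f
  rw [Finset.sum_sub_distrib]
  linarith

lemma sum_gap {m : ℕ} {x : Fin (m + 1) → ℝ} (hx : IsDesign x) : ∑ i, gap x i = 1 := by
  simp only [gap]
  rw [sum_succ_sub_castSucc, hx.2.1, hx.2.2, sub_zero]

lemma gap_pos {m : ℕ} {x : Fin (m + 1) → ℝ} (hx : StrictMono x) (i : Fin m) : 0 < gap x i :=
  sub_pos.2 (hx i.castSucc_lt_succ)

noncomputable section

/-- The correlation matrix `exp (-θ |x_k - x_l|)` of an Ornstein-Uhlenbeck process at `x`. -/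
def expCorr {n : ℕ} (θ : ℝ) (x : Fin n → ℝ) : Matrix (Fin n) (Fin n) ℝ :=
  Matrix.of fun k l => Real.exp (-θ * |x k - x l|)

/-- The increments of `exp (2 θ x_j)` along the design, starting with its first value: the pivots
in the `L D Lᵀ` factorization of `expCorr θ x`. -/
def expPivot {m : ℕ} (θ : ℝ) (x : Fin (m + 1) → ℝ) : Fin (m + 1) → ℝ :=
  Fin.cases (Real.exp (2 * θ * x 0))
    fun i => Real.exp (2 * θ * x i.succ) - Real.exp (2 * θ * x i.castSucc)

/-- The lower triangular factor with entries `exp (-θ x_k)` in the `L D Lᵀ` factorization of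
`expCorr θ x`. -/
def expFactor {m : ℕ} (θ : ℝ) (x : Fin (m + 1) → ℝ) : Matrix (Fin (m + 1)) (Fin (m + 1)) ℝ :=
  Matrix.of fun k j => if j ≤ k then Real.exp (-θ * x k) else 0

end

lemma expPivot_pos {m : ℕ} {θ : ℝ} (hθ : 0 < θ) {x : Fin (m + 1) → ℝ} (hx : StrictMono x)
    (j : Fin (m + 1)) : 0 < expPivot θ x j := by
  refine Fin.cases ?_ (fun i => ?_) j
  · simp [expPivot, Real.exp_pos]
  · simp only [expPivot, Fin.cases_succ, sub_pos, Real.exp_lt_exp]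
    have := hx i.castSucc_lt_succ
    nlinarith

lemma sum_expPivot {m : ℕ} (θ : ℝ) (x : Fin (m + 1) → ℝ) (k : Fin (m + 1)) :
    (∑ j, if j ≤ k then expPivot θ x j else 0) = Real.exp (2 * θ * x k) := by
  induction k using Fin.induction with
  | zero =>
    rw [Finset.sum_eq_single 0]
    · simp [expPivot]
    · intro j _ hj
      simp [hj]
    · simp
  | succ i ih =>
    have h : ∀ j, (if j ≤ i.succ then expPivot θ x j else 0) =
        (if j ≤ i.castSucc then expPivot θ x j else 0) +
          if j = i.succ then expPivot θ x j else 0 := by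
      intro j
      have e1 : j ≤ i.succ ↔ j.val ≤ i.val + 1 := by simp [Fin.le_def]
      have e2 : j ≤ i.castSucc ↔ j.val ≤ i.val := by simp [Fin.le_def]
      have e3 : j = i.succ ↔ j.val = i.val + 1 := by simp [Fin.ext_iff]
      simp only [e1, e2, e3]
      split_ifs <;> first | omega | simp
    rw [Finset.sum_congr rfl fun j _ => h j, Finset.sum_add_distrib, ih]
    simp [expPivot]

lemma expCorr_eq_mul {m : ℕ} (θ : ℝ) {x : Fin (m + 1) → ℝ} (hx : StrictMono x) :
    expCorr θ x =
      expFactor θ x * Matrix.diagonal (expPivot θ x) * (expFactor θ x).conjTranspose := by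
  -- both sides are symmetric, and for `k ≤ l` the pivots up to `k` sum to `exp (2 θ x_k)`
  have key : ∀ k l, k ≤ l → Real.exp (-θ * (x l - x k)) =
      ∑ j, (if j ≤ k then Real.exp (-θ * x k) else 0) * expPivot θ x j *
        (if j ≤ l then Real.exp (-θ * x l) else 0) := by
    intro k l hkl
    have h : ∀ j, (if j ≤ k then Real.exp (-θ * x k) else 0) * expPivot θ x j *
        (if j ≤ l then Real.exp (-θ * x l) else 0) =
        Real.exp (-θ * x k) * Real.exp (-θ * x l) * (if j ≤ k then expPivot θ x j else 0) := by
      intro j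
      by_cases hj : j ≤ k
      · simp only [hj, hj.trans hkl, if_true]; ring
      · simp [hj]
    rw [Finset.sum_congr rfl fun j _ => h j, ← Finset.mul_sum, sum_expPivot, ← Real.exp_add,
      ← Real.exp_add]
    congr 1
    ring
  ext k l
  rw [Matrix.mul_apply]
  simp only [Matrix.mul_diagonal, expFactor, expCorr, Matrix.of_apply, Matrix.conjTranspose_apply,
    star_trivial]
  rcases le_total k l with h | h
  · rw [← key k l h, abs_sub_comm, abs_of_nonneg (sub_nonneg.2 (hx.monotone h))]
  · rw [abs_of_nonneg (sub_nonneg.2 (hx.monotone h)), key l k h]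
    exact Finset.sum_congr rfl fun j _ => by ring

lemma posDef_expCorr {m : ℕ} {θ : ℝ} (hθ : 0 < θ) {x : Fin (m + 1) → ℝ} (hx : StrictMono x) :
    (expCorr θ x).PosDef := by
  have hdet : IsUnit (expFactor θ x).det := by
    rw [Matrix.det_of_isLowerTriangular]
    · rw [isUnit_iff_ne_zero, Finset.prod_ne_zero_iff]
      intro i _
      simp [expFactor]
    · intro i j hij
      have hij : i < j := hij
      simp [expFactor, hij]
  rw [expCorr_eq_mul θ hx]
  apply Matrix.PosDef.mul_mul_conjTranspose_same
  · exact Matrix.PosDef.diagonal (expPivot_pos hθ hx)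
  · exact Matrix.vecMul_injective_of_isUnit ((Matrix.isUnit_iff_isUnit_det _).2 hdet)

/-! ### Kriging weights of the Ornstein-Uhlenbeck process -/

/-- By the Markov property, the correlation of `x₀ ∈ [p, q]` with a point `y` outside `(p, q)` is a
combination of the correlations of `p` and `q` with `y`; the coefficients do not depend on `y`. -/
lemma exp_abs_interpolation {θ p q x₀ y : ℝ} (hp : p ≤ x₀) (hq : x₀ ≤ q) (hy : y ≤ p ∨ q ≤ y) :
    Real.sinh (θ * (q - x₀)) * Real.exp (-θ * |y - p|) +
      Real.sinh (θ * (x₀ - p)) * Real.exp (-θ * |y - q|) =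
    Real.sinh (θ * (q - p)) * Real.exp (-θ * |y - x₀|) := by
  rcases hy with hy | hy
  · rw [abs_of_nonpos (by linarith : y - p ≤ 0), abs_of_nonpos (by linarith : y - q ≤ 0),
      abs_of_nonpos (by linarith : y - x₀ ≤ 0)]
    simp only [Real.sinh_eq, div_mul_eq_mul_div, sub_mul, ← Real.exp_add]
    ring_nf
  · rw [abs_of_nonneg (by linarith : 0 ≤ y - p), abs_of_nonneg (by linarith : 0 ≤ y - q),
      abs_of_nonneg (by linarith : 0 ≤ y - x₀)]
    simp only [Real.sinh_eq, div_mul_eq_mul_div, sub_mul, ← Real.exp_add]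
    ring_nf

noncomputable section

/-- The simple kriging weights at `x₀` for the exponential correlation when `x₀` lies between the
design points `x_i` and `x_{i+1}`; all other weights vanish. -/
def krigWeight {m : ℕ} (θ : ℝ) (x : Fin (m + 1) → ℝ) (x₀ : ℝ) (i : Fin m) : Fin (m + 1) → ℝ :=
  Pi.single i.castSucc (Real.sinh (θ * (x i.succ - x₀)) / Real.sinh (θ * gap x i)) +
    Pi.single i.succ (Real.sinh (θ * (x₀ - x i.castSucc)) / Real.sinh (θ * gap x i))

/-- The solution `b` of `expCorr θ x *ᵥ b = 1`. -/
def unitWeight {m : ℕ} (θ : ℝ) (x : Fin (m + 1) → ℝ) : Fin (m + 1) → ℝ :=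
  (1 / 2 : ℝ) • (Pi.single 0 1 + Pi.single (Fin.last m) 1 +
    ∑ i : Fin m, Real.tanh (θ * gap x i / 2) • (Pi.single i.castSucc 1 + Pi.single i.succ 1))

end

lemma expCorr_mulVec_krigWeight {m : ℕ} {θ : ℝ} (hθ : 0 < θ) {x : Fin (m + 1) → ℝ}
    (hx : StrictMono x) {i : Fin m} {x₀ : ℝ} (h₀ : x₀ ∈ Set.Icc (x i.castSucc) (x i.succ)) :
    expCorr θ x *ᵥ krigWeight θ x x₀ i = fun k => Real.exp (-θ * |x k - x₀|) := by
  funext k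
  have hs : Real.sinh (θ * gap x i) ≠ 0 :=
    (Real.sinh_pos_iff.2 (mul_pos hθ (gap_pos hx i))).ne'
  have hy : x k ≤ x i.castSucc ∨ x i.succ ≤ x k := by
    rcases le_or_gt k i.castSucc with h | h
    · exact Or.inl (hx.monotone h)
    · exact Or.inr (hx.monotone (Fin.castSucc_lt_iff_succ_le.1 h))
  have := exp_abs_interpolation (θ := θ) h₀.1 h₀.2 hy
  rw [krigWeight, Matrix.mulVec_add, Matrix.mulVec_single, Matrix.mulVec_single]
  simp only [Pi.add_apply, Pi.smul_apply, Matrix.col_apply, expCorr, Matrix.of_apply,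
    MulOpposite.smul_eq_mul_unop, MulOpposite.unop_op]
  rw [gap] at hs ⊢
  field_simp
  simp only [neg_mul] at this
  linarith

lemma sum_unitWeight {m : ℕ} (θ : ℝ) (x : Fin (m + 1) → ℝ) :
    ∑ k, unitWeight θ x k = 1 + ∑ i, Real.tanh (θ * gap x i / 2) := by
  simp only [unitWeight, Pi.smul_apply, Pi.add_apply, Finset.sum_apply, smul_eq_mul]
  rw [← Finset.mul_sum, Finset.sum_add_distrib, Finset.sum_comm]
  simp only [← Finset.mul_sum, Finset.sum_add_distrib, Finset.sum_pi_single', Finset.mem_univ,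
    if_true]
  rw [← Finset.sum_mul]
  ring

lemma tanh_mul_exp_add {θ d : ℝ} (c : ℝ) :
    Real.tanh (θ * d / 2) * (Real.exp (-θ * c) + Real.exp (-θ * (c + d))) =
      Real.exp (-θ * c) - Real.exp (-θ * (c + d)) := by
  have h : 0 < Real.exp (θ * d / 2) + Real.exp (-(θ * d / 2)) := by positivity
  have e1 : Real.exp (-θ * c) =
      Real.exp (-θ * (c + d / 2)) * Real.exp (θ * d / 2) := by
    rw [← Real.exp_add]; ring_nf
  have e2 : Real.exp (-θ * (c + d)) =
      Real.exp (-θ * (c + d / 2)) * Real.exp (-(θ * d / 2)) := by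
    rw [← Real.exp_add]; ring_nf
  rw [Real.tanh_eq, e1, e2]
  field_simp

lemma expCorr_mulVec_unitWeight {m : ℕ} {θ : ℝ} {x : Fin (m + 1) → ℝ}
    (hx : StrictMono x) : expCorr θ x *ᵥ unitWeight θ x = 1 := by
  funext k
  -- `H` is an antiderivative of the row `exp (-θ |x k - ·|)` up to a factor, so the sum telescopes
  let H : Fin (m + 1) → ℝ := fun j =>
    if k ≤ j then 1 - Real.exp (-θ * (x j - x k)) else Real.exp (-θ * (x k - x j)) - 1
  have hH : ∀ i : Fin m, Real.tanh (θ * gap x i / 2) *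
      (Real.exp (-θ * |x k - x i.castSucc|) + Real.exp (-θ * |x k - x i.succ|)) =
        H i.succ - H i.castSucc := by
    intro i
    have hi := hx.monotone i.castSucc_lt_succ.le
    rcases le_or_gt k i.castSucc with h | h
    · have hk := hx.monotone h
      have := tanh_mul_exp_add (θ := θ) (d := gap x i) (x i.castSucc - x k)
      rw [show x i.castSucc - x k + gap x i = x i.succ - x k by simp [gap]] at this
      rw [abs_of_nonpos (by linarith), abs_of_nonpos (by linarith), neg_sub, neg_sub, this]
      simp only [H, h, h.trans i.castSucc_lt_succ.le, if_true]
      ring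
    · have h' : i.succ ≤ k := Fin.castSucc_lt_iff_succ_le.1 h
      have hk := hx.monotone h'
      have := tanh_mul_exp_add (θ := θ) (d := gap x i) (x k - x i.succ)
      rw [show x k - x i.succ + gap x i = x k - x i.castSucc by simp [gap]] at this
      rw [abs_of_nonneg (by linarith), abs_of_nonneg (by linarith),
        add_comm (Real.exp _), this]
      have hs : H i.succ = Real.exp (-θ * (x k - x i.succ)) - 1 := by
        rcases h'.eq_or_lt with h'' | h''
        · simp [H, h'']
        · simp [H, not_le.2 h'']
      simp only [hs, H, not_le.2 h, if_false]
      ring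
  have h0 : H 0 = Real.exp (-θ * |x k - x 0|) - 1 := by
    have := hx.monotone (Fin.zero_le k)
    rw [abs_of_nonneg (by linarith)]
    rcases (Fin.zero_le k).eq_or_lt with h | h
    · simp [H, ← h]
    · simp [H, not_le.2 h]
  have hl : H (Fin.last m) = 1 - Real.exp (-θ * |x k - x (Fin.last m)|) := by
    have := hx.monotone (Fin.le_last k)
    rw [abs_of_nonpos (by linarith)]
    simp [H, Fin.le_last]
  have hsum := sum_succ_sub_castSucc H
  simp only [← hH, h0, hl] at hsum
  rw [unitWeight, Matrix.mulVec_smul, Matrix.mulVec_add, Matrix.mulVec_add, Matrix.mulVec_sum]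
  simp only [Matrix.mulVec_smul, Matrix.mulVec_add, Matrix.mulVec_single_one, Pi.smul_apply,
    Pi.add_apply, Finset.sum_apply, Matrix.col_apply, expCorr, Matrix.of_apply, smul_eq_mul,
    Pi.one_apply]
  rw [hsum]
  ring

/-! ### The prediction error between two neighbouring design points -/

/-- Both covariance families have blocks `K`, `ρ K`, `ρ² K + B`: in the proportional one `ρ` is the
regression coefficient of the second component on the first, and `B` is a multiple of `K`. -/
lemma IsReducedModel.exists_markov_blocks {C : IsoCov} {θ σ : ℝ} (hθ : 0 < θ) (hσ : 0 < σ)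
    (hC : IsReducedModel C θ σ) {m : ℕ} {x : Fin (m + 1) → ℝ} (hx : StrictMono x) :
    ∃ (ρ : ℝ) (B : Matrix (Fin (m + 1)) (Fin (m + 1)) ℝ), B.PosDef ∧
      (∀ h, 0 ≤ h → C 1 0 h = ρ * C 0 0 h) ∧
      covBlock C x 0 1 = ρ • covBlock C x 0 0 ∧
      covBlock C x 1 0 = ρ • covBlock C x 0 0 ∧
      covBlock C x 1 1 = ρ ^ 2 • covBlock C x 0 0 + B := by
  obtain ⟨h00, ⟨ρ, σ₂₂, R, hR, hpos, h⟩ | ⟨T, Q, hT, h⟩⟩ := hC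
  · refine ⟨ρ, (σ₂₂ - ρ ^ 2 * C 0 0 0) • Matrix.of fun i j => R |x i - x j|,
      (hR.2 _ x hx.injective).smul hpos, fun y hy => ?_, ?_, ?_, ?_⟩
    · rw [(h y hy).2.1, (h y hy).1]
    all_goals
      ext k l
      obtain ⟨h1, h2, h3⟩ := h _ (abs_nonneg (x k - x l))
      simp [covBlock, h1, h2, h3]
  · have hT0 : 0 < T 0 0 := hT.diag_pos
    have hsymm : T 1 0 = T 0 1 := by simpa using hT.isHermitian.apply 0 1
    have hdet := hT.det_pos
    rw [Matrix.det_fin_two, hsymm] at hdet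
    have hQ : ∀ y, 0 ≤ y → Q y = σ / T 0 0 * Real.exp (-θ * y) := by
      intro y hy
      have := (h 0 0 y hy).symm.trans (h00 y hy)
      rw [div_mul_eq_mul_div, ← this]
      field_simp
    have hpos : 0 < (T 1 1 - T 0 1 ^ 2 / T 0 0) * (σ / T 0 0) := by
      have : T 1 1 - T 0 1 ^ 2 / T 0 0 = (T 0 0 * T 1 1 - T 0 1 * T 0 1) / T 0 0 := by
        field_simp
      rw [this]
      positivity
    refine ⟨T 0 1 / T 0 0, ((T 1 1 - T 0 1 ^ 2 / T 0 0) * (σ / T 0 0)) • expCorr θ x,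
      (posDef_expCorr hθ hx).smul hpos, fun y hy => ?_, ?_, ?_, ?_⟩
    · rw [h _ _ y hy, h _ _ y hy, hsymm]
      field_simp
    all_goals
      ext k l
      have h' := fun i j => h i j _ (abs_nonneg (x k - x l))
      simp only [covBlock, Matrix.of_apply, h', Matrix.smul_apply, Matrix.add_apply, smul_eq_mul,
        expCorr, hQ _ (abs_nonneg (x k - x l)), hsymm]
      field_simp
    ring

noncomputable section

/-- The prediction variance of simple kriging, for unit variance, at offset `u` from the midpoint of
two neighbouring design points at distance `d`. -/
def simpleVar (θ d u : ℝ) : ℝ :=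
  (Real.cosh (θ * d) - Real.cosh (2 * (θ * u))) / Real.sinh (θ * d)

/-- One minus the sum of the simple kriging weights, at offset `u` from the midpoint of two
neighbouring design points at distance `d`. -/
def meanDefect (θ d u : ℝ) : ℝ := 1 - Real.cosh (θ * u) / Real.cosh (θ * d / 2)

end

lemma simpleVar_eq {A B : ℝ} (h : Real.sinh (A + B) ≠ 0) :
    1 - (Real.sinh B / Real.sinh (A + B) * Real.exp (-A) +
      Real.sinh A / Real.sinh (A + B) * Real.exp (-B)) =
    (Real.cosh (A + B) - Real.cosh (A - B)) / Real.sinh (A + B) := by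
  field_simp
  rw [← Real.cosh_sub_sinh, ← Real.cosh_sub_sinh, Real.cosh_add, Real.cosh_sub, Real.sinh_add]
  ring

lemma meanDefect_eq {A B : ℝ} (h : Real.sinh (A + B) ≠ 0) :
    1 - (Real.sinh B / Real.sinh (A + B) + Real.sinh A / Real.sinh (A + B)) =
      1 - Real.cosh ((A - B) / 2) / Real.cosh ((A + B) / 2) := by
  obtain ⟨s, hs⟩ : ∃ s, s = (A + B) / 2 := ⟨_, rfl⟩
  obtain ⟨d, hd⟩ : ∃ d, d = (A - B) / 2 := ⟨_, rfl⟩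
  have e : A + B = 2 * s := by rw [hs]; ring
  have hA : A = s + d := by rw [hs, hd]; ring
  have hB : B = s - d := by rw [hs, hd]; ring
  have hc := (Real.cosh_pos s).ne'
  rw [e, Real.sinh_two_mul] at h
  rw [← hs, ← hd, e, Real.sinh_two_mul, hA, hB, Real.sinh_add, Real.sinh_sub]
  have hsn : Real.sinh s ≠ 0 := by
    intro h0
    simp [h0] at h
  field_simp
  ring

lemma sum_tanh_nonneg {m : ℕ} {θ : ℝ} (hθ : 0 < θ) {x : Fin (m + 1) → ℝ} (hx : StrictMono x) :
    0 ≤ ∑ i, Real.tanh (θ * gap x i / 2) :=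
  Finset.sum_nonneg fun i _ => by
    have := mul_pos hθ (gap_pos hx i)
    rw [Real.tanh_eq_sinh_div_cosh]
    exact div_nonneg (Real.sinh_nonneg_iff.2 (by linarith)) (Real.cosh_pos _).le

lemma mspeOck_eq {C : IsoCov} {θ σ : ℝ} (hθ : 0 < θ) (hσ : 0 < σ)
    (hC : IsReducedModel C θ σ) {m : ℕ} {x : Fin (m + 1) → ℝ} (hx : StrictMono x) {i : Fin m}
    {x₀ : ℝ} (h₀ : x₀ ∈ Set.Icc (x i.castSucc) (x i.succ)) :
    mspeOck C x x₀ =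
      σ * (simpleVar θ (gap x i) (x₀ - (x i.castSucc + x i.succ) / 2) +
        meanDefect θ (gap x i) (x₀ - (x i.castSucc + x i.succ) / 2) ^ 2 /
          (1 + ∑ j, Real.tanh (θ * gap x j / 2))) := by
  obtain ⟨ρ, B, hB, hv, h01, h10, h11⟩ := hC.exists_markov_blocks hθ hσ hx
  have hK : covBlock C x 0 0 = σ • expCorr θ x := by
    ext k l
    simp [covBlock, hC.1 _ (abs_nonneg (x k - x l)), expCorr]
  have hKu : IsUnit (covBlock C x 0 0).det := by
    rw [hK]
    exact (Matrix.isUnit_iff_isUnit_det _).1 ((posDef_expCorr hθ hx).smul hσ).isUnit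
  have hF : 0 < 1 + ∑ j, Real.tanh (θ * gap x j / 2) := by
    linarith [sum_tanh_nonneg hθ hx]
  have hsb : ∑ k, (σ⁻¹ • unitWeight θ x) k = σ⁻¹ * (1 + ∑ j, Real.tanh (θ * gap x j / 2)) := by
    simp only [Pi.smul_apply, smul_eq_mul]
    rw [← Finset.mul_sum, sum_unitWeight]
  rw [mspeOck_eq_of_markov_blocks (a := krigWeight θ x x₀ i) (b := σ⁻¹ • unitWeight θ x)
    h01 h10 h11 (fun k => hv _ (abs_nonneg _)) hKu hB ?_ ?_ ?_]
  · have hs : Real.sinh (θ * (x₀ - x i.castSucc) + θ * (x i.succ - x₀)) ≠ 0 := by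
      refine (Real.sinh_pos_iff.2 ?_).ne'
      have := mul_pos hθ (gap_pos hx i)
      rw [gap] at this
      linarith
    have h1 := simpleVar_eq hs
    have h2 := meanDefect_eq hs
    have e1 : θ * (x₀ - x i.castSucc) + θ * (x i.succ - x₀) = θ * gap x i := by rw [gap]; ring
    have e2 : θ * (x₀ - x i.castSucc) - θ * (x i.succ - x₀) =
        2 * (θ * (x₀ - (x i.castSucc + x i.succ) / 2)) := by ring
    rw [e1, e2] at h1 h2
    rw [mul_div_cancel_left₀ _ two_ne_zero] at h2
    rw [simpleVar, meanDefect, ← h1, ← h2, hsb, hC.1 0 le_rfl]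
    have e3 : ∑ k, C 0 0 |x k - x₀| * krigWeight θ x x₀ i k =
        σ * (Real.sinh (θ * (x i.succ - x₀)) / Real.sinh (θ * gap x i) *
            Real.exp (-(θ * (x₀ - x i.castSucc))) +
          Real.sinh (θ * (x₀ - x i.castSucc)) / Real.sinh (θ * gap x i) *
            Real.exp (-(θ * (x i.succ - x₀)))) := by
      simp only [krigWeight, Pi.add_apply, mul_add, Finset.sum_add_distrib]
      rw [Finset.sum_eq_single i.castSucc, Finset.sum_eq_single i.succ]
      · rw [hC.1 _ (abs_nonneg _), hC.1 _ (abs_nonneg _), abs_of_nonpos (by linarith [h₀.1]),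
          abs_of_nonneg (by linarith [h₀.2])]
        simp only [Pi.single_eq_same]
        ring_nf
      all_goals simp +contextual
    have e4 : ∑ k, krigWeight θ x x₀ i k =
        Real.sinh (θ * (x i.succ - x₀)) / Real.sinh (θ * gap x i) +
          Real.sinh (θ * (x₀ - x i.castSucc)) / Real.sinh (θ * gap x i) := by
      simp [krigWeight, Finset.sum_add_distrib]
    rw [e3, e4]
    simp only [mul_zero, Real.exp_zero]
    field_simp
  · rw [hK, Matrix.smul_mulVec, expCorr_mulVec_krigWeight hθ hx h₀]
    funext k
    simp [hC.1 _ (abs_nonneg (x k - x₀))]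
  · rw [hK, Matrix.smul_mulVec, Matrix.mulVec_smul, expCorr_mulVec_unitWeight hx, smul_smul,
      mul_inv_cancel₀ hσ.ne', one_smul]
  · rw [hsb]
    positivity

lemma simpleVar_nonneg {θ d u : ℝ} (hθ : 0 < θ) (hd : 0 < d) (hu : |u| ≤ d / 2) :
    0 ≤ simpleVar θ d u := by
  apply div_nonneg _ (Real.sinh_nonneg_iff.2 (mul_pos hθ hd).le)
  rw [sub_nonneg, Real.cosh_le_cosh, abs_mul, abs_mul, abs_of_pos hθ, abs_of_pos (mul_pos hθ hd),
    abs_of_pos two_pos]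
  nlinarith

/-! ### Integration over a gap -/

lemma integral_simpleVar {θ d : ℝ} (hθ : 0 < θ) (hd : 0 < d) :
    ∫ u in (-(d / 2))..(d / 2), simpleVar θ d u = d + 2 * phi θ d - 1 / θ := by
  have hs : 0 < Real.sinh (θ * d) := Real.sinh_pos_iff.2 (mul_pos hθ hd)
  have hder : ∀ u ∈ Set.uIcc (-(d / 2)) (d / 2), HasDerivAt
      (fun u => (u * Real.cosh (θ * d) - Real.sinh (2 * (θ * u)) / (2 * θ)) / Real.sinh (θ * d))
      (simpleVar θ d u) u := by
    intro u _
    have h1 : HasDerivAt (fun u : ℝ => 2 * (θ * u)) (2 * (θ * 1)) u :=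
      ((hasDerivAt_id u).const_mul θ).const_mul 2
    convert! (((hasDerivAt_id u).mul_const (Real.cosh (θ * d))).sub
      (h1.sinh.div_const (2 * θ))).div_const (Real.sinh (θ * d)) using 1
    rw [simpleVar]
    field_simp
  have hcont : Continuous (simpleVar θ d) := by
    unfold simpleVar
    have := Real.continuous_cosh
    fun_prop
  rw [intervalIntegral.integral_eq_sub_of_hasDerivAt hder (hcont.intervalIntegrable _ _)]
  have e1 : 2 * (θ * (d / 2)) = θ * d := by ring
  have e2 : 2 * (θ * -(d / 2)) = -(θ * d) := by ring
  rw [e1, e2, Real.sinh_neg, phi, show 2 * θ * d = θ * d + θ * d by ring, Real.exp_add]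
  have hE : 1 < Real.exp (θ * d) := Real.one_lt_exp_iff.2 (mul_pos hθ hd)
  have hE2 : Real.exp (θ * d) * Real.exp (θ * d) - 1 ≠ 0 := by nlinarith
  have hE3 : Real.exp (θ * d) ^ 2 - 1 ≠ 0 := by nlinarith
  rw [Real.sinh_eq, Real.cosh_eq, Real.exp_neg]
  set E := Real.exp (θ * d)
  have hE0 : E ≠ 0 := by positivity
  have hE4 : E - E⁻¹ ≠ 0 := by
    have : E - E⁻¹ = (E ^ 2 - 1) / E := by field_simp
    rw [this]
    exact div_ne_zero hE3 hE0
  field_simp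
  ring

lemma gFun_eq_tanh {θ d : ℝ} (hθ : 0 < θ) :
    gFun θ d = d - 3 / θ * Real.tanh (θ * d / 2) + d / 2 / Real.cosh (θ * d / 2) ^ 2 := by
  rw [gFun, Real.tanh_eq_sinh_div_cosh, Real.sinh_eq, Real.cosh_eq, Real.exp_neg,
    show 2 * θ * d = θ * d / 2 + θ * d / 2 + (θ * d / 2 + θ * d / 2) by ring,
    show Real.exp (θ * d) = Real.exp (θ * d / 2 + θ * d / 2) by ring_nf, Real.exp_add,
    Real.exp_add]
  set E := Real.exp (θ * d / 2)
  have hE0 : 0 < E := by positivity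
  have : 0 < E ^ 2 + 1 := by positivity
  field_simp
  ring

lemma omegaFun_eq_tanh (θ d : ℝ) : omegaFun θ d = d + Real.tanh (θ * d / 2) := by
  rw [omegaFun, Real.tanh_eq, Real.exp_neg,
    show Real.exp (θ * d) = Real.exp (θ * d / 2 + θ * d / 2) by ring_nf, Real.exp_add]
  have hE0 : 0 < Real.exp (θ * d / 2) := by positivity
  field_simp

lemma integral_meanDefect_sq {θ d : ℝ} (hθ : 0 < θ) :
    ∫ u in (-(d / 2))..(d / 2), meanDefect θ d u ^ 2 = gFun θ d := by
  have hc : 0 < Real.cosh (θ * d / 2) := Real.cosh_pos _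
  have hder : ∀ u ∈ Set.uIcc (-(d / 2)) (d / 2), HasDerivAt
      (fun u => u - 2 / (θ * Real.cosh (θ * d / 2)) * Real.sinh (θ * u) +
        (u + Real.sinh (2 * (θ * u)) / (2 * θ)) / (2 * Real.cosh (θ * d / 2) ^ 2))
      (meanDefect θ d u ^ 2) u := by
    intro u _
    have h0 : HasDerivAt (fun u : ℝ => θ * u) (θ * 1) u := (hasDerivAt_id u).const_mul θ
    have h1 : HasDerivAt (fun u : ℝ => 2 * (θ * u)) (2 * (θ * 1)) u := h0.const_mul 2
    convert! ((hasDerivAt_id u).sub (h0.sinh.const_mul (2 / (θ * Real.cosh (θ * d / 2))))).add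
      (((hasDerivAt_id u).add (h1.sinh.div_const (2 * θ))).div_const
        (2 * Real.cosh (θ * d / 2) ^ 2)) using 1
    rw [meanDefect, Real.cosh_two_mul, Real.sinh_sq]
    field_simp
    ring
  have hcont : Continuous (fun u => meanDefect θ d u ^ 2) := by
    unfold meanDefect
    have := Real.continuous_cosh
    fun_prop
  rw [intervalIntegral.integral_eq_sub_of_hasDerivAt hder (hcont.intervalIntegrable _ _),
    gFun_eq_tanh hθ, Real.tanh_eq_sinh_div_cosh]
  have e1 : θ * (d / 2) = θ * d / 2 := by ring
  have e2 : θ * -(d / 2) = -(θ * d / 2) := by ring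
  rw [e1, e2, mul_neg, Real.sinh_neg, Real.sinh_neg, Real.sinh_two_mul]
  field_simp
  ring

lemma intervalIntegrable_and_sum_integral_fin {f : ℝ → ℝ} : ∀ {m : ℕ} {x : Fin (m + 1) → ℝ},
    (∀ i : Fin m, IntervalIntegrable f volume (x i.castSucc) (x i.succ)) →
    IntervalIntegrable f volume (x 0) (x (Fin.last m)) ∧
      ∑ i : Fin m, ∫ u in (x i.castSucc)..(x i.succ), f u = ∫ u in (x 0)..(x (Fin.last m)), f u
  | 0, x, _ => by simp
  | m + 1, x, h => by
    have h1 : ∀ i : Fin m, IntervalIntegrable f volume (x i.castSucc.castSucc)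
        (x i.succ.castSucc) := fun i => h i.castSucc
    obtain ⟨h2, h3⟩ := intervalIntegrable_and_sum_integral_fin (x := fun i => x i.castSucc) h1
    have h4 := h (Fin.last m)
    refine ⟨h2.trans h4, ?_⟩
    rw [Fin.sum_univ_castSucc, ← Fin.succ_last]
    exact (congrArg (· + _) h3).trans (intervalIntegral.integral_add_adjacent_intervals h2 h4)

lemma exists_mem_Icc_gap : ∀ {m : ℕ} {x : Fin (m + 1) → ℝ} {u : ℝ}, 1 ≤ m →
    u ∈ Set.Icc (x 0) (x (Fin.last m)) → ∃ i : Fin m, u ∈ Set.Icc (x i.castSucc) (x i.succ)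
  | 1, x, u, _, hu => ⟨0, hu⟩
  | m + 2, x, u, _, hu => by
    rcases le_total u (x (Fin.last (m + 1)).castSucc) with h | h
    · obtain ⟨i, hi⟩ := exists_mem_Icc_gap (x := fun i => x i.castSucc) (Nat.le_add_left 1 m)
        (u := u) ⟨hu.1, h⟩
      exact ⟨i.castSucc, hi⟩
    · exact ⟨Fin.last (m + 1), h, hu.2⟩

lemma integral_mspeOck_gap {C : IsoCov} {θ σ : ℝ} (hθ : 0 < θ) (hσ : 0 < σ)
    (hC : IsReducedModel C θ σ) {m : ℕ} {x : Fin (m + 1) → ℝ} (hx : StrictMono x) (i : Fin m) :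
    IntervalIntegrable (mspeOck C x) volume (x i.castSucc) (x i.succ) ∧
    ∫ u in (x i.castSucc)..(x i.succ), mspeOck C x u =
      σ * (gap x i + 2 * phi θ (gap x i) - 1 / θ + gFun θ (gap x i) /
        (1 + ∑ j, Real.tanh (θ * gap x j / 2))) := by
  set F := 1 + ∑ j, Real.tanh (θ * gap x j / 2) with hF
  set c := (x i.castSucc + x i.succ) / 2 with hc
  have hle : x i.castSucc ≤ x i.succ := hx.monotone i.castSucc_lt_succ.le
  have hd := gap_pos hx i
  have hc1 : Continuous (simpleVar θ (gap x i)) := by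
    unfold simpleVar
    have := Real.continuous_cosh
    fun_prop
  have hc2 : Continuous (fun u => meanDefect θ (gap x i) u ^ 2 / F) := by
    unfold meanDefect
    have := Real.continuous_cosh
    fun_prop
  let f : ℝ → ℝ := fun u => σ * (simpleVar θ (gap x i) u + meanDefect θ (gap x i) u ^ 2 / F)
  have hf : Continuous f := (hc1.add hc2).const_mul σ
  have hEq : Set.EqOn (mspeOck C x) (fun u => f (u - c)) (Set.uIcc (x i.castSucc) (x i.succ)) := by
    intro u hu
    rw [Set.uIcc_of_le hle] at hu
    exact mspeOck_eq hθ hσ hC hx hu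
  refine ⟨(intervalIntegrable_congr (hEq.mono Set.uIoc_subset_uIcc)).2
    ((hf.comp (continuous_id.sub continuous_const)).intervalIntegrable _ _), ?_⟩
  rw [intervalIntegral.integral_congr hEq, intervalIntegral.integral_comp_sub_right,
    show x i.castSucc - c = -(gap x i / 2) by rw [hc, gap]; ring,
    show x i.succ - c = gap x i / 2 by rw [hc, gap]; ring,
    intervalIntegral.integral_const_mul, intervalIntegral.integral_add
      (hc1.intervalIntegrable _ _) (hc2.intervalIntegrable _ _), intervalIntegral.integral_div,
    integral_simpleVar hθ hd, integral_meanDefect_sq hθ]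

lemma sum_omegaFun {m : ℕ} {θ : ℝ} {x : Fin (m + 1) → ℝ} (hx : IsDesign x) :
    ∑ i, omegaFun θ (gap x i) = 1 + ∑ i, Real.tanh (θ * gap x i / 2) := by
  simp only [omegaFun_eq_tanh, Finset.sum_add_distrib, sum_gap hx]

/-- The closed form of the integrated cokriging error: each gap contributes the integral of the
simple kriging variance and of the squared mean defect, the latter divided by `1ᵀ K⁻¹ 1`. -/
lemma imspeOck_eq {C : IsoCov} {θ σ : ℝ} (hθ : 0 < θ) (hσ : 0 < σ)
    (hC : IsReducedModel C θ σ) {m : ℕ} {x : Fin (m + 1) → ℝ} (hx : IsDesign x) :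
    IntervalIntegrable (mspeOck C x) volume 0 1 ∧ imspeOck C x = imspeFormula θ σ x := by
  obtain ⟨h1, h2⟩ := intervalIntegrable_and_sum_integral_fin
    fun i => (integral_mspeOck_gap hθ hσ hC hx.1 i).1
  rw [hx.2.1, hx.2.2] at h1 h2
  refine ⟨h1, ?_⟩
  rw [imspeOck, ← h2, Finset.sum_congr rfl fun i _ => (integral_mspeOck_gap hθ hσ hC hx.1 i).2,
    imspeFormula, sum_omegaFun hx, ← Finset.mul_sum]
  simp only [Finset.sum_add_distrib, Finset.sum_sub_distrib, sum_gap hx, ← Finset.sum_div,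
    ← Finset.mul_sum, Finset.sum_const, Finset.card_univ, Fintype.card_fin, nsmul_eq_mul]
  ring

lemma imspeOck_nonneg {C : IsoCov} {θ σ : ℝ} (hθ : 0 < θ) (hσ : 0 < σ)
    (hC : IsReducedModel C θ σ) {m : ℕ} (hm : 1 ≤ m) {x : Fin (m + 1) → ℝ} (hx : IsDesign x) :
    0 ≤ imspeOck C x := by
  apply intervalIntegral.integral_nonneg zero_le_one
  intro u hu
  rw [← hx.2.1, ← hx.2.2] at hu
  obtain ⟨i, hi⟩ := exists_mem_Icc_gap hm hu
  rw [mspeOck_eq hθ hσ hC hx.1 hi]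
  have h1 := sum_tanh_nonneg hθ hx.1
  have h2 := simpleVar_nonneg hθ (gap_pos hx.1 i)
    (u := u - (x i.castSucc + x i.succ) / 2) (by
      rw [gap, abs_le]
      constructor <;> linarith [hi.1, hi.2])
  positivity

/-! ### Optimality of equal gaps -/

/-- A convex function of the gaps has its smallest sum when all gaps are equal. -/
lemma _root_.ConvexOn.card_mul_le_sum_gap {f : ℝ → ℝ} (hf : ConvexOn ℝ (Set.Ioi 0) f) {m : ℕ}
    (hm : 1 ≤ m) {x : Fin (m + 1) → ℝ} (hx : IsDesign x) :
    (m : ℝ) * f (1 / m) ≤ ∑ i, f (gap x i) := by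
  have hm0 : (0 : ℝ) < m := by exact_mod_cast hm
  have h := hf.map_sum_le (t := Finset.univ) (w := fun _ : Fin m => 1 / (m : ℝ)) (p := gap x)
    (fun _ _ => by positivity) (by simp [hm0.ne']) (fun i _ => gap_pos hx.1 i)
  simp only [smul_eq_mul, ← Finset.mul_sum, sum_gap hx, mul_one] at h
  calc (m : ℝ) * f (1 / m) ≤ m * (1 / m * ∑ i, f (gap x i)) := by gcongr
    _ = _ := by field_simp

lemma convexOn_Ioi_of_hasDerivAt2_nonneg {f f' f'' : ℝ → ℝ}
    (hf' : ∀ d, 0 < d → HasDerivAt f (f' d) d) (hf'' : ∀ d, 0 < d → HasDerivAt f' (f'' d) d)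
    (h : ∀ d, 0 < d → 0 ≤ f'' d) : ConvexOn ℝ (Set.Ioi 0) f := by
  refine convexOn_of_hasDerivWithinAt2_nonneg (convex_Ioi 0)
    (fun d hd => (hf' d hd).continuousAt.continuousWithinAt) (f' := f') (f'' := f'') ?_ ?_ ?_
  all_goals
    intro d hd
    rw [interior_Ioi] at hd
  · exact (hf' d hd).hasDerivWithinAt
  · exact (hf'' d hd).hasDerivWithinAt
  · exact h d hd

lemma hasDerivAt_tanh (y : ℝ) : HasDerivAt Real.tanh (1 / Real.cosh y ^ 2) y := by
  have h := (Real.hasDerivAt_sinh y).div (Real.hasDerivAt_cosh y) (Real.cosh_pos y).ne'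
  convert! h using 1
  · funext z
    exact Real.tanh_eq_sinh_div_cosh z
  · congr 1
    nlinarith [Real.cosh_sq y]

lemma hasDerivAt_one_div_cosh_sq (y : ℝ) :
    HasDerivAt (fun y => 1 / Real.cosh y ^ 2) (-2 * Real.tanh y / Real.cosh y ^ 2) y := by
  have hc := Real.cosh_pos y
  convert! (hasDerivAt_const y (1 : ℝ)).div ((Real.hasDerivAt_cosh y).pow 2)
    (pow_ne_zero 2 hc.ne') using 1
  rw [Real.tanh_eq_sinh_div_cosh]
  field_simp
  simp
  ring

lemma div_cosh_sq_le_tanh {y : ℝ} (hy : 0 ≤ y) : y / Real.cosh y ^ 2 ≤ Real.tanh y := by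
  have hc := Real.cosh_pos y
  rw [Real.tanh_eq_sinh_div_cosh, div_le_div_iff₀ (by positivity) hc]
  have h1 := Real.self_le_sinh_iff.2 hy
  have h2 := Real.one_le_cosh y
  calc y * Real.cosh y ≤ Real.sinh y * Real.cosh y := by gcongr
    _ ≤ Real.sinh y * Real.cosh y * Real.cosh y := le_mul_of_one_le_right (by positivity) h2
    _ = _ := by ring

lemma tanh_le_self {y : ℝ} (hy : 0 ≤ y) : Real.tanh y ≤ y := by
  have hmono : MonotoneOn (fun y => y - Real.tanh y) (Set.Ici 0) := by
    refine (monotone_of_hasDerivAt_nonneg (f' := fun y => 1 - 1 / Real.cosh y ^ 2)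
      (fun y => (hasDerivAt_id y).sub (hasDerivAt_tanh y)) fun y => ?_).monotoneOn _
    have h2 := Real.one_le_cosh y
    simp only [Pi.zero_apply, sub_nonneg]
    exact div_le_one_of_le₀ (one_le_pow₀ h2) (by positivity)
  have := hmono Set.self_mem_Ici hy hy
  simp at this
  exact this

lemma convexOn_neg_tanh {θ : ℝ} (hθ : 0 < θ) :
    ConvexOn ℝ (Set.Ioi 0) fun d => -Real.tanh (θ * d / 2) := by
  have hlin : ∀ d : ℝ, HasDerivAt (fun d => θ * d / 2) (θ * 1 / 2) d :=
    fun d => ((hasDerivAt_id d).const_mul θ).div_const 2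
  refine convexOn_Ioi_of_hasDerivAt2_nonneg
    (fun d _ => ((hasDerivAt_tanh _).comp d (hlin d)).neg)
    (fun d _ => (((hasDerivAt_one_div_cosh_sq _).comp d (hlin d)).mul_const (θ * 1 / 2)).neg) ?_
  intro d hd
  have ht : 0 ≤ Real.tanh (θ * d / 2) := by
    rw [Real.tanh_eq_sinh_div_cosh]
    exact div_nonneg (Real.sinh_nonneg_iff.2 (by positivity)) (Real.cosh_pos _).le
  have hc := Real.cosh_pos (θ * d / 2)
  have : -(-2 * Real.tanh (θ * d / 2) / Real.cosh (θ * d / 2) ^ 2 * (θ * 1 / 2) * (θ * 1 / 2)) =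
    2 * Real.tanh (θ * d / 2) / Real.cosh (θ * d / 2) ^ 2 * (θ * 1 / 2) * (θ * 1 / 2) := by ring
  rw [this]
  positivity

/-- With `y = θ d / 2`, the derivative of `g` is `tanh y (tanh y - y / cosh² y)`, a product of two
nonnegative increasing functions. -/
lemma convexOn_gFun {θ : ℝ} (hθ : 0 < θ) : ConvexOn ℝ (Set.Ioi 0) (gFun θ) := by
  have hlin : ∀ d : ℝ, HasDerivAt (fun d => θ * d / 2) (θ / 2) d := by
    intro d
    simpa using ((hasDerivAt_id d).const_mul θ).div_const 2
  let k : ℝ → ℝ := fun y => Real.tanh y * (Real.tanh y - y * (1 / Real.cosh y ^ 2))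
  let k' : ℝ → ℝ := fun y => 1 / Real.cosh y ^ 2 * (Real.tanh y - y * (1 / Real.cosh y ^ 2)) +
    Real.tanh y * (2 * y * Real.tanh y / Real.cosh y ^ 2)
  have hk : ∀ y, HasDerivAt k (k' y) y := by
    intro y
    convert! (hasDerivAt_tanh y).mul ((hasDerivAt_tanh y).sub
      ((hasDerivAt_id y).mul (hasDerivAt_one_div_cosh_sq y))) using 1
    simp only [k', id, Pi.sub_apply, Pi.mul_apply]
    ring
  have hg : ∀ y, HasDerivAt (fun y => 2 / θ * y - 3 / θ * Real.tanh y +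
      1 / θ * (y * (1 / Real.cosh y ^ 2))) (2 / θ * k y) y := by
    intro y
    have hc := Real.cosh_pos y
    convert! (((hasDerivAt_id y).const_mul (2 / θ)).sub ((hasDerivAt_tanh y).const_mul (3 / θ))).add
      (((hasDerivAt_id y).mul (hasDerivAt_one_div_cosh_sq y)).const_mul (1 / θ)) using 1
    simp only [k, id, Real.tanh_eq_sinh_div_cosh]
    field_simp
    linear_combination 2 * Real.cosh y * Real.sinh_sq y
  have hfun : gFun θ = (fun y => 2 / θ * y - 3 / θ * Real.tanh y +
      1 / θ * (y * (1 / Real.cosh y ^ 2))) ∘ fun d => θ * d / 2 := by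
    funext d
    simp only [gFun_eq_tanh hθ, Function.comp]
    field_simp
  rw [hfun]
  refine convexOn_Ioi_of_hasDerivAt2_nonneg (fun d _ => (hg _).comp d (hlin d))
    (fun d _ => (((hk _).comp d (hlin d)).const_mul (2 / θ)).mul_const (θ / 2)) ?_
  intro d hd
  have hy : 0 ≤ θ * d / 2 := by positivity
  have h1 := div_cosh_sq_le_tanh hy
  have h2 : 0 ≤ Real.tanh (θ * d / 2) - θ * d / 2 * (1 / Real.cosh (θ * d / 2) ^ 2) := by
    rw [mul_one_div]
    linarith
  have h3 : 0 ≤ Real.tanh (θ * d / 2) * (2 * (θ * d / 2) * Real.tanh (θ * d / 2) /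
      Real.cosh (θ * d / 2) ^ 2) := by
    have : Real.tanh (θ * d / 2) * (2 * (θ * d / 2) * Real.tanh (θ * d / 2) /
      Real.cosh (θ * d / 2) ^ 2) =
      Real.tanh (θ * d / 2) ^ 2 * (2 * (θ * d / 2)) / Real.cosh (θ * d / 2) ^ 2 := by ring
    rw [this]
    positivity
  have h4 : 0 ≤ k' (θ * d / 2) := by positivity
  positivity

lemma phi_eq_coth {θ d : ℝ} (hθ : 0 < θ) (hd : 0 < d) :
    phi θ d = 1 / (2 * θ) * (θ * d * (Real.cosh (θ * d) / Real.sinh (θ * d)) - θ * d) := by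
  rw [phi, show 2 * θ * d = θ * d + θ * d by ring, Real.exp_add, Real.sinh_eq, Real.cosh_eq,
    Real.exp_neg]
  have hE : 1 < Real.exp (θ * d) := Real.one_lt_exp_iff.2 (mul_pos hθ hd)
  set E := Real.exp (θ * d)
  have hE0 : E ≠ 0 := by positivity
  have hE2 : E * E - 1 ≠ 0 := by nlinarith
  have hE3 : E ^ 2 - 1 ≠ 0 := by nlinarith
  have hE4 : E - E⁻¹ ≠ 0 := by
    have : E - E⁻¹ = (E ^ 2 - 1) / E := by field_simp
    rw [this]
    exact div_ne_zero hE3 hE0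
  field_simp
  ring

lemma convexOn_phi {θ : ℝ} (hθ : 0 < θ) : ConvexOn ℝ (Set.Ioi 0) (phi θ) := by
  have hlin : ∀ d : ℝ, HasDerivAt (fun d => θ * d) θ d := by
    intro d
    simpa using (hasDerivAt_id d).const_mul θ
  -- with `y = θ d`, `2 θ φ = y coth y - y` has second derivative `2 (y coth y - 1) / sinh² y`
  have hcoth : ∀ y, 0 < y → HasDerivAt (fun y => Real.cosh y / Real.sinh y)
      (-(1 / Real.sinh y ^ 2)) y := by
    intro y hy
    have hs := Real.sinh_pos_iff.2 hy
    convert! (Real.hasDerivAt_cosh y).div (Real.hasDerivAt_sinh y) hs.ne' using 1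
    field_simp
    linarith [Real.cosh_sq y]
  have hinv : ∀ y, 0 < y → HasDerivAt (fun y => 1 / Real.sinh y ^ 2)
      (-(2 * Real.cosh y / Real.sinh y ^ 3)) y := by
    intro y hy
    have hs := Real.sinh_pos_iff.2 hy
    convert! (hasDerivAt_const y (1 : ℝ)).div ((Real.hasDerivAt_sinh y).pow 2)
      (pow_ne_zero 2 hs.ne') using 1
    field_simp
    simp
    ring
  have h1 : ∀ y, 0 < y → HasDerivAt (fun y => y * (Real.cosh y / Real.sinh y) - y)
      (Real.cosh y / Real.sinh y - y * (1 / Real.sinh y ^ 2) - 1) y := by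
    intro y hy
    convert! ((hasDerivAt_id y).mul (hcoth y hy)).sub (hasDerivAt_id y) using 1
    simp only [id]
    ring
  have h2 : ∀ y, 0 < y → HasDerivAt
      (fun y => Real.cosh y / Real.sinh y - y * (1 / Real.sinh y ^ 2) - 1)
      (2 * (y * Real.cosh y - Real.sinh y) / Real.sinh y ^ 3) y := by
    intro y hy
    have hs := Real.sinh_pos_iff.2 hy
    convert! ((hcoth y hy).sub ((hasDerivAt_id y).mul (hinv y hy))).sub_const 1 using 1
    simp only [id]
    field_simp
    ring
  have hconv : ConvexOn ℝ (Set.Ioi 0) fun d =>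
      1 / (2 * θ) * (θ * d * (Real.cosh (θ * d) / Real.sinh (θ * d)) - θ * d) := by
    refine convexOn_Ioi_of_hasDerivAt2_nonneg
      (fun d hd => ((h1 _ (mul_pos hθ hd)).comp d (hlin d)).const_mul _)
      (fun d hd => (((h2 _ (mul_pos hθ hd)).comp d (hlin d)).mul_const θ).const_mul _) ?_
    intro d hd
    have hy := mul_pos hθ hd
    have hs := Real.sinh_pos_iff.2 hy
    have ht := tanh_le_self hy.le
    rw [Real.tanh_eq_sinh_div_cosh, div_le_iff₀ (Real.cosh_pos _)] at ht
    have : 0 ≤ θ * d * Real.cosh (θ * d) - Real.sinh (θ * d) := by linarith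
    positivity
  exact hconv.congr fun d hd => (phi_eq_coth hθ hd).symm

lemma gFun_nonneg {θ d : ℝ} (hθ : 0 < θ) (hd : 0 ≤ d) : 0 ≤ gFun θ d := by
  rw [← integral_meanDefect_sq hθ]
  exact intervalIntegral.integral_nonneg (by linarith) fun u _ => sq_nonneg _

lemma isDesign_equispaced {m : ℕ} (hm : 1 ≤ m) : IsDesign (equispaced m) := by
  have hm0 : (0 : ℝ) < m := by exact_mod_cast hm
  refine ⟨fun i j hij => ?_, by simp [equispaced], by simp [equispaced, hm0.ne']⟩
  have : (i : ℝ) < j := by exact_mod_cast hij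
  simp only [equispaced]
  gcongr

lemma gap_equispaced {m : ℕ} (i : Fin m) : gap (equispaced m) i = 1 / m := by
  simp only [gap, equispaced, Fin.val_succ, Fin.val_castSucc]
  push_cast
  ring

/-- For fixed parameters equal gaps minimize the closed form: `φ` and `g` are convex, and the
denominator is largest because `tanh` is concave. -/
lemma imspeFormula_equispaced_le {θ σ : ℝ} (hθ : 0 < θ) (hσ : 0 < σ) {m : ℕ} (hm : 1 ≤ m)
    {x : Fin (m + 1) → ℝ} (hx : IsDesign x) :
    imspeFormula θ σ (equispaced m) ≤ imspeFormula θ σ x := by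
  have hphi := (convexOn_phi hθ).card_mul_le_sum_gap hm hx
  have hg := (convexOn_gFun hθ).card_mul_le_sum_gap hm hx
  have hF := (convexOn_neg_tanh hθ).card_mul_le_sum_gap hm hx
  have hFpos : 0 < 1 + ∑ i, Real.tanh (θ * gap x i / 2) := by linarith [sum_tanh_nonneg hθ hx.1]
  have hG : 0 ≤ ∑ i, gFun θ (gap x i) :=
    Finset.sum_nonneg fun i _ => gFun_nonneg hθ (gap_pos hx.1 i).le
  rw [Finset.sum_neg_distrib] at hF
  rw [imspeFormula, imspeFormula, sum_omegaFun hx, sum_omegaFun (isDesign_equispaced hm)]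
  simp only [gap_equispaced, Finset.sum_const, Finset.card_univ, Fintype.card_fin, nsmul_eq_mul]
  have hq : (m : ℝ) * gFun θ (1 / m) / (1 + m * Real.tanh (θ * (1 / m) / 2)) ≤
      (∑ i, gFun θ (gap x i)) / (1 + ∑ i, Real.tanh (θ * gap x i / 2)) :=
    div_le_div₀ hG hg hFpos (by linarith)
  gcongr

lemma phi_le {θ d : ℝ} (hθ : 0 < θ) (hd : 0 < d) : phi θ d ≤ 1 / (2 * θ) := by
  have h := Real.add_one_lt_exp (x := 2 * θ * d) (by positivity)
  have h0 : 0 < 2 * θ * d := by positivity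
  rw [phi, div_le_div_iff₀ (by linarith) (by positivity)]
  linarith

lemma gFun_le {θ d : ℝ} (hθ : 0 < θ) (hd : 0 < d) : gFun θ d ≤ d := by
  have h := div_cosh_sq_le_tanh (y := θ * d / 2) (by positivity)
  have h' : 0 ≤ Real.tanh (θ * d / 2) :=
    le_trans (by have := Real.cosh_pos (θ * d / 2); positivity) h
  have e : d / 2 / Real.cosh (θ * d / 2) ^ 2 = 1 / θ * (θ * d / 2 / Real.cosh (θ * d / 2) ^ 2) := by
    field_simp
  have h2 := mul_le_mul_of_nonneg_left h (by positivity : 0 ≤ 1 / θ)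
  have h3 : 0 ≤ 2 / θ * Real.tanh (θ * d / 2) := by positivity
  have h4 : 3 / θ * Real.tanh (θ * d / 2) =
    2 / θ * Real.tanh (θ * d / 2) + 1 / θ * Real.tanh (θ * d / 2) := by ring
  rw [gFun_eq_tanh hθ, e]
  linarith

/-- The integrated error is at most twice the variance, uniformly in `θ`. -/
lemma imspeFormula_le {θ σ : ℝ} (hθ : 0 < θ) (hσ : 0 < σ) {m : ℕ}
    {x : Fin (m + 1) → ℝ} (hx : IsDesign x) : imspeFormula θ σ x ≤ 2 * σ := by
  have h1 : ∑ i, phi θ (gap x i) ≤ m * (1 / (2 * θ)) := by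
    simpa using Finset.sum_le_sum fun i (_ : i ∈ Finset.univ) => phi_le hθ (gap_pos hx.1 i)
  have h2 : ∑ i, gFun θ (gap x i) ≤ 1 := by
    rw [← sum_gap hx]
    exact Finset.sum_le_sum fun i _ => gFun_le hθ (gap_pos hx.1 i)
  have h3 : (∑ i, gFun θ (gap x i)) / ∑ i, omegaFun θ (gap x i) ≤ 1 := by
    have := sum_tanh_nonneg hθ hx.1
    rw [sum_omegaFun hx, div_le_one (by linarith)]
    linarith
  have h4 : (m : ℝ) / θ = 2 * (m * (1 / (2 * θ))) := by field_simp
  rw [imspeFormula, mul_comm 2 σ]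
  gcongr
  linarith

/-! ### Averaging over the random parameters -/

lemma ae_mem_support_of_map_eq_withDensity {Ω : Type*} [MeasurableSpace Ω] {P : Measure Ω}
    {X : Ω → ℝ} (hX : AEMeasurable X P) {f : ℝ → ℝ} (hf : Measurable f)
    (h : P.map X = volume.withDensity fun u => ENNReal.ofReal (f u)) :
    ∀ᵐ w ∂P, X w ∈ Function.support f := by
  refine ae_of_ae_map hX (p := fun u => u ∈ Function.support f) ?_
  rw [h, ae_withDensity_iff (by fun_prop)]
  refine Filter.Eventually.of_forall fun u hu h0 => hu ?_
  rw [h0, ENNReal.ofReal_zero]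

lemma measurable_imspeFormula {m : ℕ} (x : Fin (m + 1) → ℝ) :
    Measurable fun p : ℝ × ℝ => imspeFormula p.1 p.2 x := by
  unfold imspeFormula phi gFun omegaFun
  fun_prop

end Cokriging

theorem theorem8 {Ω : Type*} [MeasurableSpace Ω] (P : Measure Ω) [IsProbabilityMeasure P]
    (m : ℕ) (hm : 1 ≤ m)
    -- the random parameters, independent, with densities `r` and `t`
    (Θ S : Ω → ℝ) (hΘ : AEMeasurable Θ P) (hS : AEMeasurable S P) (hind : IndepFun Θ S P)
    (r t : ℝ → ℝ) (hr : Measurable r) (ht : Measurable t)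
    (hr0 : ∀ u, 0 ≤ r u) (ht0 : ∀ u, 0 ≤ t u)
    (hΘr : P.map Θ = volume.withDensity (fun u => ENNReal.ofReal (r u)))
    (hSt : P.map S = volume.withDensity (fun u => ENNReal.ofReal (t u)))
    (θ₁ θ₂ : ℝ) (hθ₁ : 0 < θ₁) (hθ₁₂ : θ₁ < θ₂)
    (hrsupp : Function.support r ⊆ Set.Ioo θ₁ θ₂) (htsupp : Function.support t ⊆ Set.Ioi 0)
    -- the covariance model for given parameters; everything else in it may depend on them
    (M : ℝ → ℝ → IsoCov)
    (hM : ∀ θ ∈ Function.support r, ∀ σ ∈ Function.support t, IsReducedModel (M θ σ) θ σ) :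
    -- closed form of the IMSPE
    (∀ (C : IsoCov) (θ σ : ℝ), 0 < θ → 0 < σ → IsReducedModel C θ σ →
      ∀ x : Fin (m + 1) → ℝ, IsDesign x →
        IntervalIntegrable (mspeOck C x) volume 0 1 ∧
        imspeOck C x = imspeFormula θ σ x ∧ 0 ≤ imspeOck C x) ∧
    -- optimality of the equispaced design for the Bayesian risk
    IsDesign (equispaced m) ∧
    ∀ x : Fin (m + 1) → ℝ, IsDesign x →
      AEMeasurable (fun w => imspeOck (M (Θ w) (S w)) x) P ∧
      risk P Θ S M (equispaced m) ≤ risk P Θ S M x ∧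
      (Integrable S P →
        Integrable (fun w => imspeOck (M (Θ w) (S w)) x) P ∧
        ∫ w, imspeOck (M (Θ w) (S w)) (equispaced m) ∂P ≤
          ∫ w, imspeOck (M (Θ w) (S w)) x ∂P) := by
  have hclosed : ∀ (C : IsoCov) (θ σ : ℝ), 0 < θ → 0 < σ → IsReducedModel C θ σ →
      ∀ x : Fin (m + 1) → ℝ, IsDesign x →
        IntervalIntegrable (mspeOck C x) volume 0 1 ∧
        imspeOck C x = imspeFormula θ σ x ∧ 0 ≤ imspeOck C x :=
    fun C θ σ hθ hσ hC x hx => ⟨(imspeOck_eq hθ hσ hC hx).1, (imspeOck_eq hθ hσ hC hx).2,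
      imspeOck_nonneg hθ hσ hC hm hx⟩
  have hae : ∀ᵐ w ∂P, 0 < Θ w ∧ 0 < S w ∧ IsReducedModel (M (Θ w) (S w)) (Θ w) (S w) := by
    filter_upwards [ae_mem_support_of_map_eq_withDensity hΘ hr hΘr,
      ae_mem_support_of_map_eq_withDensity hS ht hSt] with w h1 h2
    exact ⟨hθ₁.trans (hrsupp h1).1, htsupp h2, hM _ h1 _ h2⟩
  have heq := isDesign_equispaced hm
  have hmeas : ∀ x : Fin (m + 1) → ℝ, IsDesign x →
      AEMeasurable (fun w => imspeOck (M (Θ w) (S w)) x) P := by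
    intro x hx
    refine ((measurable_imspeFormula x).comp_aemeasurable (hΘ.prodMk hS)).congr ?_
    filter_upwards [hae] with w hw
    exact (hclosed _ _ _ hw.1 hw.2.1 hw.2.2 x hx).2.1.symm
  have hle : ∀ x : Fin (m + 1) → ℝ, IsDesign x → ∀ᵐ w ∂P,
      imspeOck (M (Θ w) (S w)) (equispaced m) ≤ imspeOck (M (Θ w) (S w)) x := by
    intro x hx
    filter_upwards [hae] with w hw
    rw [(hclosed _ _ _ hw.1 hw.2.1 hw.2.2 x hx).2.1,
      (hclosed _ _ _ hw.1 hw.2.1 hw.2.2 _ heq).2.1]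
    exact imspeFormula_equispaced_le hw.1 hw.2.1 hm hx
  have hint : ∀ x : Fin (m + 1) → ℝ, IsDesign x → Integrable S P →
      Integrable (fun w => imspeOck (M (Θ w) (S w)) x) P := by
    intro x hx hSi
    refine (hSi.const_mul 2).mono' (hmeas x hx).aestronglyMeasurable ?_
    filter_upwards [hae] with w hw
    obtain ⟨-, h1, h2⟩ := hclosed _ _ _ hw.1 hw.2.1 hw.2.2 x hx
    rw [Real.norm_of_nonneg h2, h1]
    exact imspeFormula_le hw.1 hw.2.1 hx
  refine ⟨hclosed, heq, fun x hx => ⟨hmeas x hx, ?_, fun hSi => ⟨hint x hx hSi, ?_⟩⟩⟩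
  · exact lintegral_mono_ae ((hle x hx).mono fun w hw => ENNReal.ofReal_le_ofReal hw)
  · exact integral_mono_ae (hint _ heq hSi) (hint x hx hSi) (hle x hx)
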